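/- Let $K$ and $N$ be finite groups of orders $m$ and $n$. Write $\widehat{H}$ for the set of equivalence classes of irreducible complex representations of a finite group $H$, each represented by a unitary one; let $\rho_0$ denote the principal representation (the trivial one, on $\mathbb{C}$). Every $\rho\in\widehat{K\times N}$ is equivalent to $\rho_K\otimes\rho_N$ with $\rho_K\in\widehat{K}$, $\rho_N\in\widehat{N}$; call $\rho$ nonprincipal on $N$ if $\rho_N\neq\rho_0$. For $f:K\to N$ let $D_f=\sum_{g\in K}(g,f(g))\in\mathbb{C}[K\times N]$, extend $\rho$ linearly to $\mathbb{C}[K\times N]$, and put $\|u\|=\sqrt{\mathrm{tr}(u\circ u^*)}$. The function $f$ is *perfect nonlinear* if $|\{g\in K: f(ag)f(g)^{-1}=b\}|=m/n$ for all $a\in K\setminus\{1\}$ and $b\in N$; it is *bent* if $$\|\rho(D_f)\|^2=\frac{m^2(n-1)}{\dim\rho\,|\widehat{K}|\,(|\widehat{N}|-1)}\quad\text{for every }\rho\in\widehat{K\times N}\text{ nonprincipal on }N.$$ 1. If $f$ is perfect nonlinear, then $\|\rho(D_f)\|^2=m\dim\rho$ for every $\rho\in\widehat{K\times N}$ nonprincipal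 on $N$. 2. If $f$ is both perfect nonlinear and bent, then $$m(n-1)=(\dim\rho)^2\,|\widehat{K}|\,(|\widehat{N}|-1)\qquad(\ast)$$ for every $\rho$ nonprincipal on $N$, and all such $\rho$ have the same dimension. 3. For any $K,N$: $(\ast)$ holds for all $\rho\in\widehat{K\times N}$ nonprincipal on $N$ if and only if all such $\rho$ have the same dimension. This is the case if $K$ and $N$ are both Abelian. 4. A finite non-Abelian group $H$ with $H\neq[H,H]$ has a nonprincipal one-dimensional irreducible representation and a (nonprincipal) irreducible representation of dimension $>1$. 5. Suppose that at least one of $K$, $N$ is non-Abelian and distinct from its derived subgroup, and that $N$, if Abelian, is not trivial. Then there are two representations in $\widehat{K\times N}$, both nonprincipal on $N$, of different dimensions; $(\ast)$ does not hold for all $\rho$ nonprincipal on $N$; and no function $f:K\to N$ is both perfect nonlinear and bent. 6. Consequently perfect nonlinearity and bentness are nonequivalent: there are groups $K,N$ as in 5 and a function $f:K\to N$ that has exactly one of the two properties. -/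

import Mathlib

open scoped TensorProduct

noncomputable section

/-- An irreducible unitary representation of `G` on the Hermitian space `ℂ ^ dim`. Every
irreducible complex representation of a finite group is equivalent to one of these. -/
structure UnitaryIrrep (G : Type*) [Group G] where
  dim : ℕ
  rep : Representation ℂ G (EuclideanSpace ℂ (Fin dim))
  irreducible : rep.IsIrreducible
  unitary : ∀ g, rep g⁻¹ = LinearMap.adjoint (rep g)

namespace UnitaryIrrep

/-- Equivalence of representations. -/
instance setoid (G : Type*) [Group G] : Setoid (UnitaryIrrep G) where
  r ρ σ := Nonempty (Representation.Equiv ρ.rep σ.rep)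
  iseqv :=
    ⟨fun _ => ⟨Representation.Equiv.refl _⟩, fun ⟨e⟩ => ⟨e.symm⟩, fun ⟨e⟩ ⟨e'⟩ => ⟨e.trans e'⟩⟩

/-- `ρ` is (equivalent to) the principal representation `g ↦ 1` on `ℂ`. -/
def IsPrincipal {G : Type*} [Group G] (ρ : UnitaryIrrep G) : Prop :=
  Nonempty (Representation.Equiv ρ.rep (Representation.trivial ℂ G ℂ))

/-- The representation `(k, n) ↦ ρK k ⊗ ρN n` of `K × N`. -/
def outerTensor {K N : Type*} [Group K] [Group N] (ρK : UnitaryIrrep K) (ρN : UnitaryIrrep N) :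
    Representation ℂ (K × N)
      (EuclideanSpace ℂ (Fin ρK.dim) ⊗[ℂ] EuclideanSpace ℂ (Fin ρN.dim)) :=
  Representation.tprod (ρK.rep.comp (MonoidHom.fst K N)) (ρN.rep.comp (MonoidHom.snd K N))

/-- `ρ` is nonprincipal on `N`: it is equivalent to `ρK ⊗ ρN` with `ρN` not principal. -/
def NonprincipalOnRight {K N : Type*} [Group K] [Group N] (ρ : UnitaryIrrep (K × N)) : Prop :=
  ∃ (ρK : UnitaryIrrep K) (ρN : UnitaryIrrep N),
    Nonempty (Representation.Equiv ρ.rep (outerTensor ρK ρN)) ∧ ¬ ρN.IsPrincipal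

end UnitaryIrrep

/-- The dual of `G`: the set of equivalence classes of irreducible representations. -/
abbrev GroupDual (G : Type*) [Group G] : Type _ := Quotient (UnitaryIrrep.setoid G)

/-- The norm `√(tr (u ∘ u*))` of an endomorphism of a Hermitian space. -/
def traceNorm {V : Type*} [NormedAddCommGroup V] [InnerProductSpace ℂ V] [FiniteDimensional ℂ V]
    (u : V →ₗ[ℂ] V) : ℝ :=
  Real.sqrt (LinearMap.trace ℂ V (u ∘ₗ LinearMap.adjoint u)).re

/-- The graph `{(g, f g) | g ∈ K}` of `f`, as an element of the group algebra `ℂ[K × N]`. -/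
def graphElement {K N : Type*} [Group K] [Group N] [Fintype K] (f : K → N) :
    MonoidAlgebra ℂ (K × N) :=
  ∑ g : K, MonoidAlgebra.single (g, f g) 1

/-- `‖ρ(D_f)‖`, where `D_f` is the graph of `f` and `ρ` is extended linearly to `ℂ[K × N]`. -/
def graphNorm {K N : Type*} [Group K] [Group N] [Fintype K] (ρ : UnitaryIrrep (K × N))
    (f : K → N) : ℝ :=
  traceNorm (ρ.rep.asAlgebraHom (graphElement f))

/-- Perfect nonlinearity: `|{g ∈ K | f (a g) (f g)⁻¹ = b}| = |K| / |N|` for all `a ≠ 1`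
and all `b`. -/
def PerfectNonlinear {K N : Type*} [Group K] [Group N] [Fintype K] [Fintype N] (f : K → N) :
    Prop :=
  ∀ a : K, a ≠ 1 → ∀ b : N,
    (Nat.card {g : K // f (a * g) * (f g)⁻¹ = b} : ℚ) = (Fintype.card K : ℚ) / Fintype.card N

/-- Bentness: `‖ρ(D_f)‖² = m² (n - 1) / (dim ρ · |K^| · (|N^| - 1))` for every irreducible
representation `ρ` of `K × N` that is nonprincipal on `N`. -/
def Bent {K N : Type*} [Group K] [Group N] [Fintype K] [Fintype N] (f : K → N) : Prop :=
  ∀ ρ : UnitaryIrrep (K × N), ρ.NonprincipalOnRight →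
    graphNorm ρ f ^ 2 =
      (Fintype.card K : ℝ) ^ 2 * ((Fintype.card N : ℝ) - 1) /
        ((ρ.dim : ℝ) * (Nat.card (GroupDual K) : ℝ) * ((Nat.card (GroupDual N) : ℝ) - 1))

/-- The identity `m (n - 1) = (dim ρ)² |K^| (|N^| - 1)`. -/
def DimensionIdentity {K N : Type*} [Group K] [Group N] [Fintype K] [Fintype N]
    (ρ : UnitaryIrrep (K × N)) : Prop :=
  (Fintype.card K : ℝ) * ((Fintype.card N : ℝ) - 1) =
    (ρ.dim : ℝ) ^ 2 * (Nat.card (GroupDual K) : ℝ) * ((Nat.card (GroupDual N) : ℝ) - 1)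

/-- The group `G` is Abelian. -/
def IsAbelianGroup (G : Type*) [Group G] : Prop := ∀ a b : G, a * b = b * a

/-- At least one of `K`, `N` is non-Abelian and distinct from its derived subgroup, and `N`,
when Abelian, is not trivial. -/
def NonAbelianCase (K N : Type*) [Group K] [Group N] : Prop :=
  ((¬ IsAbelianGroup K ∧ commutator K ≠ ⊤) ∨ (¬ IsAbelianGroup N ∧ commutator N ≠ ⊤)) ∧
    (IsAbelianGroup N → Nontrivial N)

end

/-!
For `ρ` nonprincipal on `N`, the sum `∑ b, ρ (a, b)` over `N` vanishes: it factors through the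
operator `∑ b, ρ_N b`, whose image consists of fixed vectors of a nonprincipal irreducible
representation (`UnitaryIrrep.NonprincipalOnRight.sum_rep_eq_zero`). Expand `ρ(D_f) ∘ ρ(D_f)*` as
`∑ a, ∑ h, ρ (a, f (a h) (f h)⁻¹)`. If `f` is perfect nonlinear, the inner sum is a multiple of
`∑ b, ρ (a, b) = 0` for each `a ≠ 1`, which leaves `|K|` times the identity
(`PerfectNonlinear.comp_adjoint`). The trace gives `‖ρ(D_f)‖² = |K| dim ρ`, and comparison with the
value demanded by bentness gives the dimension identity.

The dimension identity determines `dim ρ`. Conversely, the outer tensor products of irreducible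
representations are irreducible, and `∑ (dim σ)² = |G|` over the dual of a finite group `G`
(`GroupDual.sum_dim_sq`). So the sum of `(dim ρ_K)² (dim ρ_N)²` over the pairs with `ρ_N`
nonprincipal is `|K| (|N| - 1)`, and if all terms are equal this is the identity
(`UnitaryIrrep.NonprincipalOnRight.dimensionIdentity_of_forall_dim_eq`).

The facts on finite groups rest on two points. By the unitary trick every irreducible representation
is equivalent to a unitary one (`UnitaryIrrep.exists_equiv`), and by Maschke's theorem the
irreducible representations separate the elements of the group algebra
(`UnitaryIrrep.eq_zero_of_forall_asAlgebraHom_eq_zero`). The latter yields the sum of the squares of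
the dimensions, and an irreducible representation of dimension greater than one for every
non-Abelian group (`UnitaryIrrep.exists_one_lt_dim`). A group different from its derived subgroup has
a nonprincipal one-dimensional representation, so in the non-Abelian case two different dimensions
occur (`NonAbelianCase.exists_dim_ne`), and no function is both perfect nonlinear and bent. A perfect
nonlinear function from the non-Abelian group `D₄ × C₂` to `C₂` then shows that the two notions are
not equivalent (`perfectNonlinear_dihedralBent`).
-/

open scoped TensorProduct MonoidAlgebra InnerProductSpace

/-! ### Irreducibility and unitarity of representations of finite groups -/

namespace Representation

variable {G V W : Type*} [Group G] [AddCommGroup V] [Module ℂ V] [AddCommGroup W] [Module ℂ W]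

/-- The converse of Schur's lemma: by Maschke's theorem a subrepresentation is the image of an
equivariant projection. -/
theorem isIrreducible_of_finrank_intertwiningMap_eq_one [Finite G] [Nontrivial V]
    (ρ : Representation ℂ G V) (h : Module.finrank ℂ (IntertwiningMap ρ ρ) = 1) :
    ρ.IsIrreducible := by
  have hG : NeZero (Nat.card G : ℂ) := ⟨Nat.cast_ne_zero.mpr Nat.card_pos.ne'⟩
  have hnt : Nontrivial ρ.asModule := inferInstanceAs (Nontrivial V)
  rw [irreducible_iff_isSimpleModule_asModule, isSimpleModule_iff]
  have h' : Module.finrank ℂ (Module.End ℂ[G] ρ.asModule) = 1 := by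
    rw [← h]; exact (IntertwiningMap.equivAlgEnd (ρ := ρ)).toLinearEquiv.finrank_eq.symm
  refine { exists_pair_ne := ⟨⊥, ⊤, bot_ne_top⟩, eq_bot_or_eq_top := fun p => ?_ }
  obtain ⟨q, hq⟩ := MonoidAlgebra.Submodule.exists_isCompl p
  obtain ⟨c, hc⟩ := (finrank_eq_one_iff_of_nonzero' (1 : Module.End ℂ[G] ρ.asModule)
    one_ne_zero).mp h' (Submodule.projection p q hq)
  -- the equivariant projection onto `p` is a scalar `c`, so `p` is trivial
  rcases eq_or_ne c 0 with rfl | hc0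
  · left
    rw [eq_bot_iff]
    intro x hx
    have := Submodule.projection_apply_left hq ⟨x, hx⟩
    rw [← hc] at this
    simpa using this.symm
  · right
    rw [eq_top_iff]
    intro x _
    have h1 : c • x ∈ p := by
      have := Submodule.projection_apply_mem hq x
      rw [← hc] at this
      simpa using this
    have h2 := p.smul_of_tower_mem c⁻¹ h1
    rwa [smul_smul, inv_mul_cancel₀ hc0, one_smul] at h2

/-- A representation is irreducible if and only if its character has norm one. -/
theorem isIrreducible_iff_sum_character [Fintype G] [FiniteDimensional ℂ V] [Nontrivial V]
    (ρ : Representation ℂ G V) :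
    ρ.IsIrreducible ↔ ∑ g : G, ρ.character g * ρ.character g⁻¹ = Nat.card G := by
  have hG : (Nat.card G : ℂ) ≠ 0 := Nat.cast_ne_zero.mpr Nat.card_pos.ne'
  have := invertibleOfNonzero hG
  have key := card_inv_mul_sum_char_mul_char_eq_finrank ρ ρ
  constructor
  · intro h
    rw [IsIrreducible.finrank_intertwiningMap_self, Nat.cast_one, inv_mul_eq_one₀ hG] at key
    exact key.symm
  · intro h
    refine isIrreducible_of_finrank_intertwiningMap_eq_one ρ ?_
    rw [h, inv_mul_cancel₀ hG] at key
    exact_mod_cast key.symm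

theorem IsIrreducible.nontrivial (ρ : Representation ℂ G V) [h : ρ.IsIrreducible] :
    Nontrivial V := by
  have := IsSimpleModule.nontrivial ℂ[G] ρ.asModule
  exact this

theorem Equiv.isIrreducible [Finite G] [FiniteDimensional ℂ V] [FiniteDimensional ℂ W]
    {ρ : Representation ℂ G V} {σ : Representation ℂ G W} (e : Equiv ρ σ) [ρ.IsIrreducible] :
    σ.IsIrreducible := by
  cases nonempty_fintype G
  have := IsIrreducible.nontrivial ρ
  have : Nontrivial W := e.toLinearEquiv.symm.toEquiv.nontrivial
  rw [isIrreducible_iff_sum_character, ← char_iso e, ← isIrreducible_iff_sum_character]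
  infer_instance

/-- Weyl's unitary trick. The map `v ↦ (ρ g v)_g` embeds `V` into a finite power of a Hermitian
space, on which `G` acts by permuting the factors, hence by isometries. -/
theorem exists_adjoint_equiv [Finite G] [FiniteDimensional ℂ V] (ρ : Representation ℂ G V) :
    ∃ σ : Representation ℂ G (EuclideanSpace ℂ (Fin (Module.finrank ℂ V))),
      (∀ g, σ g⁻¹ = LinearMap.adjoint (σ g)) ∧ Nonempty (Equiv σ ρ) := by
  cases nonempty_fintype G
  let E := EuclideanSpace ℂ (Fin (Module.finrank ℂ V))
  obtain ⟨b⟩ : Nonempty (V ≃ₗ[ℂ] E) :=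
    FiniteDimensional.nonempty_linearEquiv_of_finrank_eq (by simp [E])
  -- `b` is any identification with a Hermitian space; it need not respect the action
  let φ : V →ₗ[ℂ] PiLp 2 (fun _ : G => E) :=
    (WithLp.linearEquiv 2 ℂ (G → E)).symm.toLinearMap ∘ₗ
      LinearMap.pi fun g => b.toLinearMap ∘ₗ ρ g
  have hφ : ∀ v g, φ v g = b (ρ g v) := fun v g => rfl
  have hinj : Function.Injective φ := fun v w h => by
    have : φ v 1 = φ w 1 := by rw [h]
    simpa [hφ] using this
  let e₀ := LinearEquiv.ofInjective φ hinj
  have hdim : Module.finrank ℂ (LinearMap.range φ) = Module.finrank ℂ V := e₀.finrank_eq.symm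
  let u := (stdOrthonormalBasis ℂ (LinearMap.range φ)).reindex (finCongr hdim)
  let e : V ≃ₗ[ℂ] E := e₀.trans u.repr.toLinearEquiv
  have he : ∀ v w, ⟪e v, e w⟫_ℂ = ∑ g, ⟪b (ρ g v), b (ρ g w)⟫_ℂ := fun v w => by
    have : ⟪e v, e w⟫_ℂ = ⟪e₀ v, e₀ w⟫_ℂ := u.repr.inner_map_map _ _
    rw [this, Submodule.coe_inner, PiLp.inner_apply]
    rfl
  have hinv : ∀ g v w, ⟪e (ρ g v), e (ρ g w)⟫_ℂ = ⟪e v, e w⟫_ℂ := fun g v w => by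
    rw [he, he, ← Equiv.sum_comp (Equiv.mulRight g)
      (fun h => ⟪b (ρ h v), b (ρ h w)⟫_ℂ)]
    simp
  let σ : Representation ℂ G E :=
    { toFun := fun g => e.conj (ρ g)
      map_one' := by ext; simp
      map_mul' := fun g h => by ext; simp }
  have hσ : ∀ g x, σ g x = e (ρ g (e.symm x)) := fun g x => rfl
  refine ⟨σ, fun g => ?_, ⟨Equiv.mk e.symm fun g => ?_⟩⟩
  · rw [LinearMap.eq_adjoint_iff]
    intro x y
    have h := hinv g (ρ g⁻¹ (e.symm x)) (e.symm y)
    rw [self_inv_apply, e.apply_symm_apply] at h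
    rw [hσ, hσ, h, e.apply_symm_apply]
  · ext x
    simp [hσ]

theorem Equiv.map_asAlgebraHom {ρ : Representation ℂ G V} {σ : Representation ℂ G W}
    (e : Equiv ρ σ) (x : ℂ[G]) (v : V) :
    e (ρ.asAlgebraHom x v) = σ.asAlgebraHom x (e v) := by
  induction x using MonoidAlgebra.induction_linear with
  | zero => simp
  | add x y hx hy => simp [hx, hy]
  | single g r =>
    have := IntertwiningMap.isIntertwining _ _ e.toIntertwiningMap g v
    simp only [asAlgebraHom_single, LinearMap.smul_apply, map_smul]
    congr 1

theorem Equiv.asAlgebraHom_eq_zero {ρ : Representation ℂ G V} {σ : Representation ℂ G W}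
    (e : Equiv ρ σ) {x : ℂ[G]} (h : ρ.asAlgebraHom x = 0) : σ.asAlgebraHom x = 0 := by
  ext w
  have := e.map_asAlgebraHom x (e.symm w)
  rw [h, e.apply_symm_apply] at this
  simpa using this.symm

theorem Equiv.finrank_eq {ρ : Representation ℂ G V} {σ : Representation ℂ G W}
    (e : Equiv ρ σ) : Module.finrank ℂ V = Module.finrank ℂ W :=
  e.toLinearEquiv.finrank_eq

end Representation

/-! ### Irreducible representations separate the group algebra -/

namespace UnitaryIrrep

open Representation

variable {G V : Type*} [Group G] [AddCommGroup V] [Module ℂ V]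

/-- Every irreducible complex representation of a finite group is equivalent to a unitary one. -/
theorem exists_equiv [Finite G] [FiniteDimensional ℂ V] (ρ : Representation ℂ G V)
    [ρ.IsIrreducible] : ∃ σ : UnitaryIrrep G, Nonempty (Equiv σ.rep ρ) := by
  obtain ⟨σ, hσ, ⟨e⟩⟩ := exists_adjoint_equiv ρ
  exact ⟨⟨_, σ, e.symm.isIrreducible, hσ⟩, ⟨e⟩⟩

theorem dim_eq_finrank {σ : UnitaryIrrep G} {ρ : Representation ℂ G V} (e : Equiv σ.rep ρ) :
    σ.dim = Module.finrank ℂ V := by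
  simpa using e.finrank_eq

theorem dim_pos (σ : UnitaryIrrep G) : 0 < σ.dim := by
  have := σ.irreducible
  have := IsIrreducible.nontrivial σ.rep
  simpa using Module.finrank_pos (R := ℂ) (M := EuclideanSpace ℂ (Fin σ.dim))

theorem smul_eq_zero_of_forall_asAlgebraHom_eq_zero [Finite G] (M : Type*) [AddCommGroup M]
    [Module ℂ M] [Module ℂ[G] M] [IsScalarTower ℂ ℂ[G] M] [IsSimpleModule ℂ[G] M] {x : ℂ[G]}
    (h : ∀ σ : UnitaryIrrep G, σ.rep.asAlgebraHom x = 0) (m : M) : x • m = 0 := by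
  let ρ : Representation ℂ G M := ofModule' M
  have hρ : ρ.asAlgebraHom = Algebra.lsmul ℂ ℂ M :=
    (MonoidAlgebra.lift ℂ (M →ₗ[ℂ] M) G).apply_symm_apply _
  let e : ρ.asModule ≃ₗ[ℂ[G]] M :=
    { ρ.asModuleEquiv with
      map_smul' := fun r y => (ρ.asModuleEquiv_map_smul r y).trans (by rw [hρ]; rfl) }
  have : ρ.IsIrreducible :=
    (irreducible_iff_isSimpleModule_asModule ρ).mpr (IsSimpleModule.congr e)
  have : FiniteDimensional ℂ M := Module.Finite.trans ℂ[G] M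
  obtain ⟨σ, ⟨e⟩⟩ := exists_equiv ρ
  have h0 := e.asAlgebraHom_eq_zero (h σ)
  rw [hρ] at h0
  exact LinearMap.congr_fun h0 m

/-- The irreducible representations separate the elements of the group algebra, because the
regular representation is a sum of irreducible ones. -/
theorem eq_zero_of_forall_asAlgebraHom_eq_zero [Finite G] {x : ℂ[G]}
    (h : ∀ σ : UnitaryIrrep G, σ.rep.asAlgebraHom x = 0) : x = 0 := by
  have hG : NeZero (Nat.card G : ℂ) := ⟨Nat.cast_ne_zero.mpr Nat.card_pos.ne'⟩
  -- `{y | x * y = 0}` need not be a left ideal, but it is closed under addition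
  have hall : ∀ y ∈ (⊤ : Submodule ℂ[G] ℂ[G]), x * y = 0 := by
    intro y hy
    rw [← IsSemisimpleModule.sSup_simples_eq_top ℂ[G] ℂ[G], sSup_eq_iSup'] at hy
    induction hy using Submodule.iSup_induction' with
    | mem S y hy =>
      have : IsSimpleModule ℂ[G] S.1 := S.2
      exact congrArg Subtype.val
        (smul_eq_zero_of_forall_asAlgebraHom_eq_zero S.1 h (⟨y, hy⟩ : S.1))
    | zero => simp
    | add y z _ _ hy hz => rw [mul_add, hy, hz, add_zero]
  simpa using hall 1 trivial

theorem eq_of_forall_rep_eq [Finite G] {g h : G}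
    (hgh : ∀ σ : UnitaryIrrep G, σ.rep g = σ.rep h) : g = h := by
  have := eq_zero_of_forall_asAlgebraHom_eq_zero
    (x := MonoidAlgebra.single g (1 : ℂ) - MonoidAlgebra.single h 1) fun σ => by simp [hgh σ]
  rw [sub_eq_zero] at this
  exact MonoidAlgebra.of_injective (R := ℂ) this

end UnitaryIrrep

/-! ### Orthogonality of characters and the sum of the squares of the dimensions -/

namespace GroupDual

open Representation UnitaryIrrep

variable {G : Type*} [Group G]

theorem mk_out_equiv (σ : UnitaryIrrep G) :
    Nonempty (Equiv (Quotient.out (⟦σ⟧ : GroupDual G)).rep σ.rep) :=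
  Quotient.mk_out σ

open scoped Classical in
theorem sum_character_mul_character [Fintype G] (p q : GroupDual G) :
    ∑ g : G, p.out.rep.character g * q.out.rep.character g⁻¹ =
      if p = q then (Nat.card G : ℂ) else 0 := by
  have hG : (Nat.card G : ℂ) ≠ 0 := Nat.cast_ne_zero.mpr Nat.card_pos.ne'
  have := invertibleOfNonzero hG
  have := p.out.irreducible
  have := q.out.irreducible
  have key := char_orthonormal p.out.rep q.out.rep
  rw [inv_mul_eq_iff_eq_mul₀ hG] at key
  rw [key]
  have : Nonempty (Equiv q.out.rep p.out.rep) ↔ p = q := by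
    rw [eq_comm, ← Quotient.out_equiv_out]; rfl
  simp [this]

theorem linearIndependent_character [Finite G] :
    LinearIndependent ℂ fun p : GroupDual G => p.out.rep.character := by
  cases nonempty_fintype G
  rw [linearIndependent_iff']
  intro s c hc q hq
  have hG : (Nat.card G : ℂ) ≠ 0 := Nat.cast_ne_zero.mpr Nat.card_pos.ne'
  have h : ∑ g : G, (∑ p ∈ s, c p • p.out.rep.character) g * q.out.rep.character g⁻¹ = 0 := by
    rw [hc]
    simp only [Pi.zero_apply, zero_mul, Finset.sum_const_zero]
  simp_rw [Finset.sum_apply, Finset.sum_mul] at h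
  rw [Finset.sum_comm] at h
  simp_rw [Pi.smul_apply, smul_eq_mul, mul_assoc, ← Finset.mul_sum,
    sum_character_mul_character] at h
  simpa [hq, hG] using h

instance finite [Finite G] : Finite (GroupDual G) := linearIndependent_character.finite

theorem character_one (p : GroupDual G) : p.out.rep.character 1 = p.out.dim := by simp

/-- The element `∑ g, (∑ p, dim p * χ_p g⁻¹) g - |G|` of the group algebra is central, and its
trace in each irreducible representation vanishes by the orthogonality of characters. So it acts by
zero in each of them, hence is zero; its coefficient at `1` is `∑ p, (dim p)² - |G|`. -/
theorem sum_dim_sq [Finite G] [Fintype (GroupDual G)] :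
    ∑ p : GroupDual G, p.out.dim ^ 2 = Nat.card G := by
  cases nonempty_fintype G
  let a : G → ℂ := fun g => ∑ p : GroupDual G, p.out.dim * p.out.rep.character g⁻¹
  have ha : ∀ g h : G, a (h * g * h⁻¹) = a g := fun g h => by
    simp only [a, mul_inv_rev, inv_inv, ← mul_assoc]
    simp only [mul_assoc]
    simp only [← mul_assoc, char_conj]
  let x : ℂ[G] := ∑ g : G, MonoidAlgebra.single g (a g) - MonoidAlgebra.single 1 (Nat.card G : ℂ)
  have hx : x = 0 := by
    refine eq_zero_of_forall_asAlgebraHom_eq_zero fun σ => ?_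
    have := σ.irreducible
    have hxσ : σ.rep.asAlgebraHom x = ∑ g, a g • σ.rep g - (Nat.card G : ℂ) • 1 := by
      simp [x]
    have hcomm : ∀ h, σ.rep.asAlgebraHom x ∘ₗ σ.rep h = σ.rep h ∘ₗ σ.rep.asAlgebraHom x := by
      intro h
      rw [hxσ]
      change (_ : Module.End ℂ _) * _ = _ * _
      rw [sub_mul, mul_sub, Finset.sum_mul, Finset.mul_sum,
        ← Equiv.sum_comp (MulAut.conj h).toEquiv]
      simp [ha, ← map_mul]
    -- Schur's lemma: the central element `x` acts by a scalar `c`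
    obtain ⟨c, hc⟩ := IsIrreducible.algebraMap_intertwiningMap_bijective_of_isAlgClosed.2
      (⟨σ.rep.asAlgebraHom x, hcomm⟩ : IntertwiningMap σ.rep σ.rep)
    have hc' : σ.rep.asAlgebraHom x = c • 1 := by
      have := congrArg IntertwiningMap.toLinearMap hc
      exact this.symm
    have htr : LinearMap.trace ℂ _ (σ.rep.asAlgebraHom x) = 0 := by
      obtain ⟨e⟩ := mk_out_equiv σ
      have hdim : (σ.dim : ℂ) = (Quotient.out (⟦σ⟧ : GroupDual G)).dim := by
        rw [dim_eq_finrank e, finrank_euclideanSpace_fin]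
      have htr' : LinearMap.trace ℂ _ (σ.rep.asAlgebraHom x) =
          ∑ g, a g * σ.rep.character g - Nat.card G * σ.dim := by
        rw [hxσ]; simp [character]
      rw [htr', ← char_iso e, hdim]
      simp_rw [a, Finset.sum_mul]
      rw [Finset.sum_comm]
      simp_rw [mul_assoc, ← Finset.mul_sum, mul_comm (character _ _⁻¹),
        sum_character_mul_character]
      simp [mul_comm]
    rw [hc'] at htr ⊢
    have hd : (σ.dim : ℂ) ≠ 0 := Nat.cast_ne_zero.mpr σ.dim_pos.ne'
    have : c = 0 := by simpa [hd] using htr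
    simp [this]
  have h1 := congrArg (fun y : ℂ[G] => y.coeff 1) hx
  have h2 : a 1 = Nat.card G := by
    classical
    simpa [x, sub_eq_zero, Finsupp.single_apply] using h1
  simp only [a, inv_one, character_one, ← pow_two] at h2
  exact_mod_cast h2

end GroupDual

/-! ### Representations of small dimension and fixed vectors -/

namespace UnitaryIrrep

open Representation

variable {G : Type*} [Group G]

theorem isPrincipal_iff_of_equiv {σ τ : UnitaryIrrep G} (e : Equiv σ.rep τ.rep) :
    σ.IsPrincipal ↔ τ.IsPrincipal :=
  ⟨fun ⟨f⟩ => ⟨e.symm.trans f⟩, fun ⟨f⟩ => ⟨e.trans f⟩⟩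

theorem IsPrincipal.dim_eq {σ : UnitaryIrrep G} (h : σ.IsPrincipal) : σ.dim = 1 := by
  obtain ⟨e⟩ := h
  simpa using dim_eq_finrank e

/-- An irreducible representation with a nonzero fixed vector is principal: the vector spans the
image of an intertwining map from the principal representation. -/
theorem isPrincipal_of_fixed {σ : UnitaryIrrep G} {v : EuclideanSpace ℂ (Fin σ.dim)} (hv : v ≠ 0)
    (h : ∀ g, σ.rep g v = v) : σ.IsPrincipal := by
  have := σ.irreducible
  let f : IntertwiningMap (Representation.trivial ℂ G ℂ) σ.rep :=
    ⟨LinearMap.toSpanSingleton ℂ _ v, fun g => by ext; simp [h g]⟩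
  have hf : ∀ c, f c = c • v := fun c => rfl
  have hinj : Function.Injective f := fun c d hcd => by
    rw [hf, hf] at hcd
    exact smul_left_injective ℂ hv hcd
  rcases IsIrreducible.surjective_or_eq_zero f with hs | h0
  · exact ⟨(IntertwiningMap.ofBijective f ⟨hinj, hs⟩).symm⟩
  · refine absurd ?_ hv
    have := hf 1
    rw [h0] at this
    simpa using this.symm

/-- The vectors in the image of `∑ g, σ g` are fixed. -/
theorem sum_rep_eq_zero [Fintype G] {σ : UnitaryIrrep G} (h : ¬ σ.IsPrincipal) :
    ∑ g : G, σ.rep g = 0 := by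
  by_contra h0
  obtain ⟨v, hv⟩ : ∃ v, σ.rep.norm v ≠ 0 := by
    by_contra! hall
    exact h0 (LinearMap.ext hall)
  exact h (isPrincipal_of_fixed hv fun g => σ.rep.self_norm_apply g v)

/-- A linear character, viewed as a unitary irreducible representation. -/
theorem exists_dim_eq_one [Finite G] (χ : G →* ℂˣ) :
    ∃ σ : UnitaryIrrep G, σ.dim = 1 ∧ (σ.IsPrincipal ↔ χ = 1) := by
  cases nonempty_fintype G
  let ρ : Representation ℂ G ℂ :=
    { toFun := fun g => (χ g : ℂ) • LinearMap.id
      map_one' := by ext; simp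
      map_mul' := fun g h => by ext; simp [mul_comm] }
  have hρ : ∀ g z, ρ g z = χ g * z := fun g z => rfl
  have hchar : ∀ g, ρ.character g = χ g := fun g => by
    change LinearMap.trace ℂ ℂ ((χ g : ℂ) • LinearMap.id) = _
    simp
  have : ρ.IsIrreducible := by
    rw [isIrreducible_iff_sum_character]
    simp [hchar]
  obtain ⟨σ, ⟨e⟩⟩ := exists_equiv ρ
  refine ⟨σ, by simpa using dim_eq_finrank e, fun ⟨f⟩ => ?_, fun h => ?_⟩
  · ext g
    have := congrFun (char_iso (e.symm.trans f)) g
    rw [hchar] at this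
    exact this.trans (by simp [character, Representation.trivial])
  · refine ⟨e.trans (Representation.Equiv.mk (LinearEquiv.refl ℂ ℂ) fun g => ?_)⟩
    ext
    simp [hρ, h]

theorem exists_isPrincipal (G : Type*) [Group G] [Finite G] : ∃ σ : UnitaryIrrep G, σ.IsPrincipal :=
  let ⟨σ, _, h⟩ := exists_dim_eq_one (1 : G →* ℂˣ)
  ⟨σ, h.mpr rfl⟩

theorem IsPrincipal.rep_eq_one {σ : UnitaryIrrep G} (h : σ.IsPrincipal) (g : G) :
    σ.rep g = 1 := by
  obtain ⟨e⟩ := h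
  ext1 v
  apply e.toLinearEquiv.injective
  exact IntertwiningMap.isIntertwining _ _ e.toIntertwiningMap g v

theorem exists_not_isPrincipal [Finite G] [Nontrivial G] :
    ∃ σ : UnitaryIrrep G, ¬ σ.IsPrincipal := by
  by_contra! h
  obtain ⟨g, hg⟩ := exists_ne (1 : G)
  exact hg (eq_of_forall_rep_eq fun σ => by rw [(h σ).rep_eq_one, map_one])

/-- The Abelianization is a nontrivial finite Abelian group, so it has a nontrivial character. -/
theorem exists_not_isPrincipal_dim_eq_one [Finite G] (h : commutator G ≠ ⊤) :
    ∃ σ : UnitaryIrrep G, ¬ σ.IsPrincipal ∧ σ.dim = 1 := by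
  obtain ⟨g, hg⟩ : ∃ g, g ∉ commutator G := by
    by_contra! hall
    exact h (eq_top_iff.mpr fun g _ => hall g)
  have hg' : Abelianization.of g ≠ 1 := by
    rwa [← Abelianization.ker_of, MonoidHom.mem_ker] at hg
  obtain ⟨χ, hχ⟩ :=
    CommGroup.exists_apply_ne_one_of_hasEnoughRootsOfUnity (Abelianization G) ℂ hg'
  obtain ⟨σ, hσ, hσ'⟩ := exists_dim_eq_one (χ.comp Abelianization.of)
  refine ⟨σ, fun hp => hχ ?_, hσ⟩
  exact DFunLike.congr_fun (hσ'.mp hp) g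

/-- One-dimensional representations take commuting values, and the irreducible representations
separate the elements of `G`. -/
theorem exists_one_lt_dim [Finite G] (h : ¬ IsAbelianGroup G) :
    ∃ σ : UnitaryIrrep G, 1 < σ.dim := by
  by_contra! hall
  refine h fun a b => eq_of_forall_rep_eq fun σ => ?_
  have h1 : Module.finrank ℂ (EuclideanSpace ℂ (Fin σ.dim)) = 1 := by
    simpa using le_antisymm (hall σ) σ.dim_pos
  obtain ⟨v, hv, hspan⟩ := finrank_eq_one_iff'.mp h1
  obtain ⟨s, hs⟩ := hspan (σ.rep a v)
  obtain ⟨t, ht⟩ := hspan (σ.rep b v)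
  ext1 w
  obtain ⟨c, rfl⟩ := hspan w
  simp only [map_mul, Module.End.mul_apply, map_smul]
  rw [← hs, ← ht, map_smul, map_smul, ← hs, ← ht, smul_comm s t]

theorem dim_eq_one_of_isAbelianGroup (h : IsAbelianGroup G) (σ : UnitaryIrrep G) : σ.dim = 1 := by
  have := σ.irreducible
  have : IsMulCommutative G := ⟨⟨h⟩⟩
  simpa using IsIrreducible.finrank_eq_one_of_isMulCommutative σ.rep

/-! ### Outer tensor products -/

section Product

variable {K N : Type*} [Group K] [Group N]

theorem character_outerTensor (ρK : UnitaryIrrep K) (ρN : UnitaryIrrep N) (g : K × N) :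
    (outerTensor ρK ρN).character g = ρK.rep.character g.1 * ρN.rep.character g.2 :=
  congrFun (char_tensor _ _) g

/-- The outer tensor product of irreducible representations is irreducible: the norm of its
character is the product of the norms of the characters of the factors. -/
theorem isIrreducible_outerTensor [Finite K] [Finite N] (ρK : UnitaryIrrep K)
    (ρN : UnitaryIrrep N) : (outerTensor ρK ρN).IsIrreducible := by
  cases nonempty_fintype K
  cases nonempty_fintype N
  have := ρK.irreducible
  have := ρN.irreducible
  have := IsIrreducible.nontrivial ρK.rep
  have := IsIrreducible.nontrivial ρN.rep
  have hK := (isIrreducible_iff_sum_character ρK.rep).mp ρK.irreducible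
  have hN := (isIrreducible_iff_sum_character ρN.rep).mp ρN.irreducible
  have : Nontrivial (EuclideanSpace ℂ (Fin ρK.dim) ⊗[ℂ] EuclideanSpace ℂ (Fin ρN.dim)) := by
    apply Module.nontrivial_of_finrank_pos (R := ℂ)
    simp [ρK.dim_pos, ρN.dim_pos]
  rw [isIrreducible_iff_sum_character, Nat.card_prod, Nat.cast_mul, ← hK, ← hN,
    Finset.sum_mul_sum, Fintype.sum_prod_type]
  refine Finset.sum_congr rfl fun k _ => Finset.sum_congr rfl fun n _ => ?_
  rw [character_outerTensor, character_outerTensor]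
  exact mul_mul_mul_comm _ _ _ _

theorem dim_eq_mul {ρ : UnitaryIrrep (K × N)} {ρK : UnitaryIrrep K} {ρN : UnitaryIrrep N}
    (e : Equiv ρ.rep (outerTensor ρK ρN)) : ρ.dim = ρK.dim * ρN.dim := by
  simpa using dim_eq_finrank e

theorem exists_nonprincipalOnRight [Finite K] [Finite N] (ρK : UnitaryIrrep K)
    {ρN : UnitaryIrrep N} (h : ¬ ρN.IsPrincipal) :
    ∃ ρ : UnitaryIrrep (K × N), ρ.NonprincipalOnRight ∧ ρ.dim = ρK.dim * ρN.dim := by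
  have := isIrreducible_outerTensor ρK ρN
  obtain ⟨ρ, ⟨e⟩⟩ := exists_equiv (outerTensor ρK ρN)
  exact ⟨ρ, ⟨ρK, ρN, ⟨e⟩, h⟩, dim_eq_mul e⟩

theorem NonprincipalOnRight.sum_rep_eq_zero [Fintype N] {ρ : UnitaryIrrep (K × N)}
    (h : ρ.NonprincipalOnRight) (a : K) : ∑ b : N, ρ.rep (a, b) = 0 := by
  obtain ⟨ρK, ρN, ⟨e⟩, hN⟩ := h
  have hsum : ∑ b : N, outerTensor ρK ρN (a, b) = 0 := by
    have : ∀ b, outerTensor ρK ρN (a, b) =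
        TensorProduct.mapBilinear (RingHom.id ℂ) _ _ _ _ (ρK.rep a) (ρN.rep b) := fun b => rfl
    simp_rw [this, ← map_sum, UnitaryIrrep.sum_rep_eq_zero hN, map_zero]
  apply e.toLinearEquiv.conj.injective
  rw [map_sum, map_zero, ← hsum]
  exact Finset.sum_congr rfl fun b _ => e.conj_apply_self (a, b)

end Product

end UnitaryIrrep

open UnitaryIrrep

/-! ### The graph of a perfect nonlinear function -/

section PerfectNonlinear

variable {K N : Type*} [Group K] [Group N] [Fintype K] [Fintype N]

/-- Perfect nonlinearity says that each `b : N` occurs `|K| / |N|` times among the values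
`f (a * h) * (f h)⁻¹`, so the sum is a multiple of `∑ b, ρ (a, b) = 0`. -/
theorem PerfectNonlinear.sum_rep_eq_zero {f : K → N} (hf : PerfectNonlinear f)
    {ρ : UnitaryIrrep (K × N)} (hρ : ρ.NonprincipalOnRight) {a : K} (ha : a ≠ 1) :
    ∑ h : K, ρ.rep (a, f (a * h) * (f h)⁻¹) = 0 := by
  classical
  rw [← Finset.sum_fiberwise Finset.univ (fun h => f (a * h) * (f h)⁻¹)]
  have hcard : ∀ b, ((Finset.univ.filter fun h => f (a * h) * (f h)⁻¹ = b).card : ℂ) =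
      (Fintype.card K : ℂ) / Fintype.card N := fun b => by
    have := hf a ha b
    rw [Nat.card_eq_fintype_card, Fintype.card_subtype] at this
    have h' := congrArg (fun q : ℚ => (q : ℂ)) this
    push_cast at h'
    exact h'
  have hfib : ∀ b, ∑ h with f (a * h) * (f h)⁻¹ = b, ρ.rep (a, f (a * h) * (f h)⁻¹) =
      ((Fintype.card K : ℂ) / Fintype.card N) • ρ.rep (a, b) := fun b => by
    rw [← hcard b, Nat.cast_smul_eq_nsmul, ← Finset.sum_const]
    exact Finset.sum_congr rfl fun h hh => by rw [(Finset.mem_filter.mp hh).2]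
  simp_rw [hfib, ← Finset.smul_sum, hρ.sum_rep_eq_zero, smul_zero]

/-- Expanding `ρ(D_f) ∘ ρ(D_f)*` and collecting the terms with the same first component `a` leaves
`|K|` times the identity: the sum over `a = 1` is constant, and the others vanish. -/
theorem PerfectNonlinear.comp_adjoint {f : K → N} (hf : PerfectNonlinear f)
    {ρ : UnitaryIrrep (K × N)} (hρ : ρ.NonprincipalOnRight) :
    ρ.rep.asAlgebraHom (graphElement f) ∘ₗ
      LinearMap.adjoint (ρ.rep.asAlgebraHom (graphElement f)) =
        (Fintype.card K : ℂ) • (1 : Module.End ℂ _) := by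
  classical
  have h1 : ρ.rep.asAlgebraHom (graphElement f) = ∑ g : K, ρ.rep (g, f g) := by
    simp [graphElement]
  have h2 : LinearMap.adjoint (ρ.rep.asAlgebraHom (graphElement f)) =
      ∑ g : K, ρ.rep (g, f g)⁻¹ := by
    simp_rw [h1, map_sum, ρ.unitary]
  rw [h2, h1]
  change (_ : Module.End ℂ _) * _ = _
  simp_rw [Finset.sum_mul_sum, ← map_mul]
  rw [Finset.sum_comm]
  have h3 : ∀ h : K, ∑ g : K, ρ.rep ((g, f g) * (h, f h)⁻¹) =
      ∑ a : K, ρ.rep (a, f (a * h) * (f h)⁻¹) := fun h => by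
    -- substitute `g = a * h`
    rw [← Equiv.sum_comp (Equiv.mulRight h)]
    simp
  simp_rw [h3]
  rw [Finset.sum_comm, Finset.sum_eq_single 1 (fun a _ ha => hf.sum_rep_eq_zero hρ ha) (by simp)]
  have h4 : ∀ h : K, ρ.rep (1, f (1 * h) * (f h)⁻¹) = 1 := fun h => by
    rw [one_mul, mul_inv_cancel, Prod.mk_one_one, map_one]
  rw [Finset.sum_congr rfl fun h _ => h4 h, Finset.sum_const, Finset.card_univ,
    Nat.cast_smul_eq_nsmul]

theorem PerfectNonlinear.graphNorm_sq {f : K → N} (hf : PerfectNonlinear f)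
    {ρ : UnitaryIrrep (K × N)} (hρ : ρ.NonprincipalOnRight) :
    graphNorm ρ f ^ 2 = (Fintype.card K : ℝ) * ρ.dim := by
  have : (LinearMap.trace ℂ (EuclideanSpace ℂ (Fin ρ.dim))
      ((Fintype.card K : ℂ) • (1 : Module.End ℂ _))).re = (Fintype.card K : ℝ) * ρ.dim := by
    simp
  rw [graphNorm, traceNorm, hf.comp_adjoint hρ, this, Real.sq_sqrt (by positivity)]

end PerfectNonlinear

/-! ### Dimensions of the representations nonprincipal on `N` -/

section Dimensions

variable {K N : Type*} [Group K] [Group N] [Fintype K] [Fintype N]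

theorem card_groupDual_pos (G : Type*) [Group G] [Finite G] : 0 < Nat.card (GroupDual G) := by
  obtain ⟨σ, -⟩ := exists_isPrincipal G
  have : Nonempty (GroupDual G) := ⟨⟦σ⟧⟩
  exact Nat.card_pos

theorem one_lt_card_groupDual {G : Type*} [Group G] [Finite G] {σ : UnitaryIrrep G}
    (h : ¬ σ.IsPrincipal) : 1 < Nat.card (GroupDual G) := by
  obtain ⟨τ, hτ⟩ := exists_isPrincipal G
  rw [Finite.one_lt_card_iff_nontrivial]
  refine ⟨⟦σ⟧, ⟦τ⟧, fun heq => h ?_⟩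
  obtain ⟨e⟩ := Quotient.exact heq
  exact (isPrincipal_iff_of_equiv e).mpr hτ

namespace UnitaryIrrep.NonprincipalOnRight

theorem card_mul_pos {ρ : UnitaryIrrep (K × N)} (h : ρ.NonprincipalOnRight) :
    0 < (Nat.card (GroupDual K) : ℝ) * ((Nat.card (GroupDual N) : ℝ) - 1) := by
  obtain ⟨-, ρN, -, hN⟩ := h
  have h1 : (1 : ℝ) < Nat.card (GroupDual N) := by exact_mod_cast one_lt_card_groupDual hN
  have h2 : (0 : ℝ) < Nat.card (GroupDual K) := by exact_mod_cast card_groupDual_pos K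
  exact mul_pos h2 (sub_pos.mpr h1)

theorem dim_eq_of_dimensionIdentity {ρ σ : UnitaryIrrep (K × N)} (hρ : ρ.NonprincipalOnRight)
    (h : DimensionIdentity ρ) (h' : DimensionIdentity σ) : ρ.dim = σ.dim := by
  have hpos := hρ.card_mul_pos
  rw [DimensionIdentity, mul_assoc] at h h'
  have h2 := mul_right_cancel₀ hpos.ne' (h.symm.trans h')
  exact_mod_cast (pow_left_inj₀ (Nat.cast_nonneg _) (Nat.cast_nonneg _) two_ne_zero).mp h2

/-- The left-hand side of the identity is `∑ (dim ρK)² (dim ρN)²` over the pairs of classes with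
`ρN` not principal, and there are `|K^| (|N^| - 1)` such pairs. -/
theorem dimensionIdentity_of_forall_dim_eq
    (h : ∀ ρ σ : UnitaryIrrep (K × N), ρ.NonprincipalOnRight → σ.NonprincipalOnRight →
      ρ.dim = σ.dim)
    {ρ : UnitaryIrrep (K × N)} (hρ : ρ.NonprincipalOnRight) : DimensionIdentity ρ := by
  classical
  cases nonempty_fintype (GroupDual K)
  cases nonempty_fintype (GroupDual N)
  obtain ⟨τ, hτ⟩ := exists_isPrincipal N
  let q₀ : GroupDual N := ⟦τ⟧
  have hq₀ : q₀.out.dim = 1 :=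
    ((isPrincipal_iff_of_equiv (GroupDual.mk_out_equiv τ).some).mpr hτ).dim_eq
  have hN : ∑ q ∈ Finset.univ.erase q₀, (q.out.dim : ℝ) ^ 2 = (Fintype.card N : ℝ) - 1 := by
    have := Finset.sum_erase_add Finset.univ (fun q : GroupDual N => (q.out.dim : ℝ) ^ 2)
      (Finset.mem_univ q₀)
    rw [hq₀, Nat.cast_one, one_pow] at this
    rw [eq_sub_iff_add_eq, this, ← Nat.card_eq_fintype_card]
    exact_mod_cast GroupDual.sum_dim_sq (G := N)
  have hK : ∑ p : GroupDual K, (p.out.dim : ℝ) ^ 2 = Fintype.card K := by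
    rw [← Nat.card_eq_fintype_card]
    exact_mod_cast GroupDual.sum_dim_sq (G := K)
  have hd : ∀ p : GroupDual K, ∀ q ∈ Finset.univ.erase q₀,
      (p.out.dim : ℝ) ^ 2 * (q.out.dim : ℝ) ^ 2 = (ρ.dim : ℝ) ^ 2 := by
    intro p q hq
    have hnp : ¬ q.out.IsPrincipal := fun ⟨e⟩ => by
      obtain ⟨e'⟩ := hτ
      refine (Finset.mem_erase.mp hq).1 ?_
      rw [← Quotient.out_eq q]
      exact Quotient.sound ⟨e.trans e'.symm⟩
    obtain ⟨σ, hσ, hdim⟩ := exists_nonprincipalOnRight p.out hnp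
    rw [h ρ σ hρ hσ, hdim, Nat.cast_mul, mul_pow]
  rw [DimensionIdentity, ← hK, ← hN, Finset.sum_mul_sum,
    Finset.sum_congr rfl fun p _ => Finset.sum_congr rfl (hd p)]
  have : Nonempty (GroupDual N) := ⟨q₀⟩
  have hcard : (((Finset.univ.erase q₀).card : ℕ) : ℝ) = (Nat.card (GroupDual N) : ℝ) - 1 := by
    rw [Finset.card_erase_of_mem (Finset.mem_univ _), Finset.card_univ,
      Nat.cast_pred Fintype.card_pos, Nat.card_eq_fintype_card]
  simp only [Finset.sum_const, nsmul_eq_mul, hcard, Finset.card_univ, Nat.card_eq_fintype_card]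
  ring

end UnitaryIrrep.NonprincipalOnRight

/-- Perfect nonlinearity and bentness prescribe two values for `‖ρ(D_f)‖²`; the identity says that
they agree. -/
theorem PerfectNonlinear.dimensionIdentity_of_bent {f : K → N} (hf : PerfectNonlinear f)
    (hb : Bent f) {ρ : UnitaryIrrep (K × N)} (hρ : ρ.NonprincipalOnRight) :
    DimensionIdentity ρ := by
  have hpos := hρ.card_mul_pos
  have hd : (0 : ℝ) < ρ.dim := by exact_mod_cast ρ.dim_pos
  have hm : (0 : ℝ) < Fintype.card K := by exact_mod_cast Fintype.card_pos
  have h := (hf.graphNorm_sq hρ).symm.trans (hb ρ hρ)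
  rw [mul_assoc (ρ.dim : ℝ), eq_div_iff (mul_pos hd hpos).ne'] at h
  rw [DimensionIdentity]
  apply mul_left_cancel₀ hm.ne'
  linarith

/-- On an Abelian product all irreducible representations have dimension one. -/
theorem dimensionIdentity_of_isAbelianGroup (hK : IsAbelianGroup K) (hN : IsAbelianGroup N)
    {ρ : UnitaryIrrep (K × N)} (hρ : ρ.NonprincipalOnRight) : DimensionIdentity ρ := by
  have h : IsAbelianGroup (K × N) := fun a b => Prod.ext (hK _ _) (hN _ _)
  refine NonprincipalOnRight.dimensionIdentity_of_forall_dim_eq (fun σ τ _ _ => ?_) hρ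
  rw [dim_eq_one_of_isAbelianGroup h, dim_eq_one_of_isAbelianGroup h]

/-- If `K` is non-Abelian, a fixed nonprincipal representation of `N` is tensored with irreducible
representations of `K` of dimension one and greater than one. Otherwise the principal representation
of `K` is tensored with nonprincipal representations of `N` of dimension one and greater than one;
the one of dimension one exists because `N` differs from its derived subgroup. -/
theorem NonAbelianCase.exists_dim_ne (h : NonAbelianCase K N) :
    ∃ ρ σ : UnitaryIrrep (K × N), ρ.NonprincipalOnRight ∧ σ.NonprincipalOnRight ∧
      ρ.dim ≠ σ.dim := by
  obtain ⟨hcase, hN⟩ := h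
  have key : ∀ {ρK σK : UnitaryIrrep K} {ρN σN : UnitaryIrrep N}, ¬ ρN.IsPrincipal →
      ¬ σN.IsPrincipal → ρK.dim * ρN.dim ≠ σK.dim * σN.dim →
      ∃ ρ σ : UnitaryIrrep (K × N), ρ.NonprincipalOnRight ∧ σ.NonprincipalOnRight ∧
        ρ.dim ≠ σ.dim := by
    intro ρK σK ρN σN hρ hσ hne
    obtain ⟨ρ, hρ', hρd⟩ := exists_nonprincipalOnRight ρK hρ
    obtain ⟨σ, hσ', hσd⟩ := exists_nonprincipalOnRight σK hσ
    exact ⟨ρ, σ, hρ', hσ', by rwa [hρd, hσd]⟩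
  obtain ⟨τ, hτ⟩ := exists_isPrincipal K
  rcases hcase with ⟨hK, -⟩ | ⟨hNab, hcomm⟩
  · have : Nontrivial N := by
      by_cases hab : IsAbelianGroup N
      · exact hN hab
      · by_contra hnt
        have := not_nontrivial_iff_subsingleton.mp hnt
        exact hab fun a b => Subsingleton.elim _ _
    obtain ⟨σN, hσN⟩ := exists_not_isPrincipal (G := N)
    obtain ⟨σK, hσK⟩ := exists_one_lt_dim hK
    refine key (ρK := τ) (σK := σK) hσN hσN ?_
    rw [hτ.dim_eq, one_mul]
    exact (lt_mul_left σN.dim_pos hσK).ne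
  · obtain ⟨ρN, hρN, hρd⟩ := exists_not_isPrincipal_dim_eq_one hcomm
    obtain ⟨σN, hσd⟩ := exists_one_lt_dim hNab
    refine key (ρK := τ) (σK := τ) (σN := σN) hρN (fun hp => hσd.ne' hp.dim_eq) ?_
    rw [hτ.dim_eq, hρd, one_mul, one_mul]
    exact hσd.ne

theorem NonAbelianCase.not_forall_dimensionIdentity (h : NonAbelianCase K N) :
    ¬ ∀ ρ : UnitaryIrrep (K × N), ρ.NonprincipalOnRight → DimensionIdentity ρ := by
  obtain ⟨ρ, σ, hρ, hσ, hne⟩ := h.exists_dim_ne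
  exact fun hall => hne (hρ.dim_eq_of_dimensionIdentity (hall ρ hρ) (hall σ hσ))

end Dimensions

/-! ### A perfect nonlinear function that is not bent -/

section Example

/-- The function on the group `D₄ × C₂` of order 16 with values in the group of order 2 whose
support is `{(r⁰, 1), (r¹, 0), (r², 0), (r³, 0), (s, 0), (s, 1)}`, a difference set with parameters
`(16, 6, 2)`. -/
def dihedralBent : DihedralGroup 4 × Multiplicative (ZMod 2) → Multiplicative (ZMod 2)
  | (.r i, z) => if i = 0 then z else z * Multiplicative.ofAdd 1
  | (.sr i, _) => if i = 0 then Multiplicative.ofAdd 1 else 1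

theorem perfectNonlinear_dihedralBent : PerfectNonlinear dihedralBent := by
  have h : ∀ a, a ≠ 1 → ∀ b,
      Fintype.card {g // dihedralBent (a * g) * (dihedralBent g)⁻¹ = b} = 8 := by
    decide +kernel
  intro a ha b
  have hK : Fintype.card (DihedralGroup 4 × Multiplicative (ZMod 2)) = 16 := by decide
  have hN : Fintype.card (Multiplicative (ZMod 2)) = 2 := by decide
  rw [Nat.card_eq_fintype_card, h a ha b, hK, hN]
  norm_num

theorem nonAbelianCase_dihedral :
    NonAbelianCase (DihedralGroup 4 × Multiplicative (ZMod 2)) (Multiplicative (ZMod 2)) := by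
  have hnab : ¬ IsAbelianGroup (DihedralGroup 4 × Multiplicative (ZMod 2)) := fun h =>
    absurd (h (.r 1, 1) (.sr 0, 1)) (by decide)
  refine ⟨Or.inl ⟨hnab, ?_⟩, fun _ => inferInstance⟩
  -- a nontrivial `2`-group is solvable, so it differs from its derived subgroup
  have hp : IsPGroup 2 (DihedralGroup 4 × Multiplicative (ZMod 2)) :=
    IsPGroup.of_card (n := 4) (by rw [Nat.card_eq_fintype_card]; decide)
  have := hp.isNilpotent
  have : Nontrivial (DihedralGroup 4 × Multiplicative (ZMod 2)) := ⟨(.r 1, 1), 1, by decide⟩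
  exact (Group.IsSolvable.commutator_lt_top_of_nontrivial _).ne

end Example

/-! ### Perfect nonlinearity and bentness -/

theorem mainTheorem3 :
    (∀ (K : Type*) (N : Type*) [Group K] [Group N] [Fintype K] [Fintype N],
      -- a perfect nonlinear function has `‖ρ(D_f)‖² = m dim ρ`
      (∀ f : K → N, PerfectNonlinear f → ∀ ρ : UnitaryIrrep (K × N), ρ.NonprincipalOnRight →
        graphNorm ρ f ^ 2 = (Fintype.card K : ℝ) * ρ.dim) ∧
      -- if it is also bent, then `m (n - 1) = (dim ρ)² |K^| (|N^| - 1)`, and the dimensions agree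
      (∀ f : K → N, PerfectNonlinear f → Bent f →
        (∀ ρ : UnitaryIrrep (K × N), ρ.NonprincipalOnRight → DimensionIdentity ρ) ∧
        (∀ ρ σ : UnitaryIrrep (K × N), ρ.NonprincipalOnRight → σ.NonprincipalOnRight →
          ρ.dim = σ.dim)) ∧
      -- the identity holds for all `ρ` nonprincipal on `N` iff these have the same dimension
      ((∀ ρ : UnitaryIrrep (K × N), ρ.NonprincipalOnRight → DimensionIdentity ρ) ↔
        (∀ ρ σ : UnitaryIrrep (K × N), ρ.NonprincipalOnRight → σ.NonprincipalOnRight →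
          ρ.dim = σ.dim)) ∧
      (IsAbelianGroup K → IsAbelianGroup N →
        ∀ ρ : UnitaryIrrep (K × N), ρ.NonprincipalOnRight → DimensionIdentity ρ) ∧
      -- the non-Abelian case
      (NonAbelianCase K N →
        (∃ ρ σ : UnitaryIrrep (K × N), ρ.NonprincipalOnRight ∧ σ.NonprincipalOnRight ∧
          ρ.dim ≠ σ.dim) ∧
        (¬ ∀ ρ : UnitaryIrrep (K × N), ρ.NonprincipalOnRight → DimensionIdentity ρ) ∧
        ¬ ∃ f : K → N, PerfectNonlinear f ∧ Bent f)) ∧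
    (∀ (H : Type*) [Group H] [Finite H], ¬ IsAbelianGroup H → commutator H ≠ ⊤ →
      (∃ ρ : UnitaryIrrep H, ¬ ρ.IsPrincipal ∧ ρ.dim = 1) ∧
      (∃ ρ : UnitaryIrrep H, ¬ ρ.IsPrincipal ∧ 1 < ρ.dim)) ∧
    -- the two notions are not equivalent
    (∃ (K N : Type) (_ : Group K) (_ : Group N) (_ : Fintype K) (_ : Fintype N),
      NonAbelianCase K N ∧ ∃ f : K → N, ¬ (PerfectNonlinear f ↔ Bent f)) := by
  refine ⟨fun K N _ _ _ _ => ⟨fun f hf ρ hρ => hf.graphNorm_sq hρ, fun f hf hb => ?_, ?_,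
    fun hK hN ρ hρ => dimensionIdentity_of_isAbelianGroup hK hN hρ, fun h => ?_⟩,
    fun H _ _ hab hcomm => ⟨exists_not_isPrincipal_dim_eq_one hcomm, ?_⟩, ?_⟩
  · have h := fun (ρ : UnitaryIrrep (K × N)) (hρ : ρ.NonprincipalOnRight) =>
      hf.dimensionIdentity_of_bent hb hρ
    exact ⟨h, fun ρ σ hρ hσ => hρ.dim_eq_of_dimensionIdentity (h ρ hρ) (h σ hσ)⟩
  · exact ⟨fun h ρ σ hρ hσ => hρ.dim_eq_of_dimensionIdentity (h ρ hρ) (h σ hσ),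
      fun h ρ hρ => NonprincipalOnRight.dimensionIdentity_of_forall_dim_eq h hρ⟩
  · exact ⟨h.exists_dim_ne, h.not_forall_dimensionIdentity, fun ⟨f, hf, hb⟩ =>
      h.not_forall_dimensionIdentity fun ρ hρ => hf.dimensionIdentity_of_bent hb hρ⟩
  · obtain ⟨σ, hσ⟩ := exists_one_lt_dim hab
    exact ⟨σ, fun hp => hσ.ne' hp.dim_eq, hσ⟩
  · refine ⟨_, _, _, _, inferInstance, inferInstance, nonAbelianCase_dihedral, dihedralBent,
      fun h => ?_⟩
    exact nonAbelianCase_dihedral.not_forall_dimensionIdentity fun ρ hρ =>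
      perfectNonlinear_dihedralBent.dimensionIdentity_of_bent
        (h.mp perfectNonlinear_dihedralBent) hρ
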